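/- **Corollary 8 (FELD for the Wishart autoregressive process).** Let $(Y_t)_{t\ge 0}$ be a WAR(1) process with degrees of freedom $K\in\mathbb R$, autoregressive matrix $M\in\mathbb R^{n\times n}$ and symmetric positive semi-definite innovation matrix $\Sigma$. That is, $(Y_t)$ takes values in the symmetric positive semi-definite $n\times n$ matrices, is adapted to a filtration $(I_t)$, and for every $t$ and every symmetric positive semi-definite $\Gamma$, almost surely $$\mathbb E[\exp(-\mathrm{Tr}(\Gamma Y_{t+1}))\mid I_t]=\frac{\exp\left[-\mathrm{Tr}\left(M'\,\Gamma(Id+2\Sigma\Gamma)^{-1}M\,Y_t\right)\right]}{\det(Id+2\Sigma\Gamma)^{K/2}} .$$ For $h\ge 0$ put $\Psi(\Gamma,h\mid I_t)=\mathbb E[\exp(-\mathrm{Tr}(\Gamma Y_{t+h}))\mid I_t]$ and $\Sigma_h=\sum_{j=0}^{h-1}M^j\Sigma (M^j)'$ (so $\Sigma_0=0$). Fix a date $t$ at which $Y_t$ is integrable, and a symmetric positive semi-definite matrix $\Gamma$. Then $\det(Id+2\Sigma_m\Gamma)>0$ for all $m\ge0$, and almost surely, for every $h\ge 0$, $$\Psi(\Gamma,h\mid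 I_t)=\frac{\exp\left[-\mathrm{Tr}\left((M^h)'\,\Gamma(Id+2\Sigma_h\Gamma)^{-1}M^h\,Y_t\right)\right]}{\det(Id+2\Sigma_h\Gamma)^{K/2}},$$ and the forecast error Laplace decomposition (FELD) $$\mathbb E\left\{\log\frac{\Psi(\Gamma,h\mid I_t)}{\exp(-\mathrm{Tr}(\Gamma Y_{t+h}))}\,\Big|\,I_t\right\}=\sum_{k=0}^{h-1}\gamma(k,h),\qquad \gamma(k,h)=\mathbb E\left\{\log\frac{\Psi(\Gamma,h-k\mid I_{t+k})}{\Psi(\Gamma,h-k-1\mid I_{t+k+1})}\,\Big|\,I_t\right\},$$ holds, all the logarithms in it being integrable. For $0\le k<h$ its generic term is, almost surely, $$\begin{aligned}\gamma(k,h)={}&\mathrm{Tr}\left\{(M^h)'\left[\Gamma(Id+2\Sigma_{h-k-1}\Gamma)^{-1}-\Gamma(Id+2\Sigma_{h-k}\Gamma)^{-1}\right]M^hY_t\right\}\\ &+\mathrm{Tr}\left[(M^{h-k-1})'\,\Gamma(Id+2\Sigma_{h-k-1}\Gamma)^{-1}M^{h-k-1}\,K\Sigma_{k+1}\right]\\ &-\mathrm{Tr}\left[(M^{h-k})'\,\Gamma(Id+2\Sigma_{h-k}\Gamma)^{-1}M^{h-k}\,K\Sigma_{k}\right]\\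 &-\frac K2\log\frac{\det(Id+2\Sigma_{h-k}\Gamma)}{\det(Id+2\Sigma_{h-k-1}\Gamma)} ,\end{aligned}$$ the first line being its $Y_t$-dependent element. -/

import Mathlib

open MeasureTheory

noncomputable section

/-- `Σ_h = Σ + M Σ M' + ⋯ + M^(h-1) Σ (M^(h-1))'`, with `Σ_0 = 0`. -/
def warSigma {n : ℕ} (M S : Matrix (Fin n) (Fin n) ℝ) (h : ℕ) : Matrix (Fin n) (Fin n) ℝ :=
  ∑ j ∈ Finset.range h, M ^ j * S * (M ^ j).transpose

/-- Wishart autoregressive process of order one, with degrees of freedom `K`, autoregressive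
matrix `M` and innovation matrix `S`: a process of symmetric positive semi-definite matrices,
adapted to the information `𝓕`, whose conditional Laplace transform at horizon one given `𝓕 t` is
`exp(-Tr(M' Γ (Id + 2 S Γ)⁻¹ M Y_t)) / det(Id + 2 S Γ)^(K/2)` for every symmetric positive
semi-definite argument `Γ`. It depends on `𝓕 t` through `Y_t` only: this is the Markov property,
since these transforms determine the conditional law. -/
structure IsWAR {Ω : Type*} {mΩ : MeasurableSpace Ω} (μ : Measure Ω) (𝓕 : Filtration ℕ mΩ) {n : ℕ}
    (K : ℝ) (M S : Matrix (Fin n) (Fin n) ℝ) (Y : ℕ → Ω → Matrix (Fin n) (Fin n) ℝ) : Prop where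
  posSemidef_innovation : S.PosSemidef
  adapted : ∀ t i j, StronglyMeasurable[𝓕 t] (fun ω => Y t ω i j)
  posSemidef : ∀ t, ∀ᵐ ω ∂μ, (Y t ω).PosSemidef
  laplace : ∀ t (Γ : Matrix (Fin n) (Fin n) ℝ), Γ.PosSemidef →
    μ[fun ω => Real.exp (-(Γ * Y (t + 1) ω).trace) | 𝓕 t] =ᵐ[μ] fun ω =>
      Real.exp (-(M.transpose * (Γ * (1 + (2 : ℝ) • (S * Γ))⁻¹) * M * Y t ω).trace) /
        (1 + (2 : ℝ) • (S * Γ)).det ^ (K / 2)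

section FELD

variable {Ω : Type*} {mΩ : MeasurableSpace Ω} (μ : Measure Ω) (𝓕 : Filtration ℕ mΩ) {n : ℕ}
  (Y : ℕ → Ω → Matrix (Fin n) (Fin n) ℝ) (Γ : Matrix (Fin n) (Fin n) ℝ)

/-- The conditional Laplace transform `Ψ(Γ, h | I_t) = E[exp(-Tr(Γ Y_{t+h})) | I_t]`. -/
def condLaplace (h t : ℕ) : Ω → ℝ :=
  μ[fun ω => Real.exp (-(Γ * Y (t + h) ω).trace) | 𝓕 t]

/-- `log [Ψ(Γ, h | I_t) / exp(-Tr(Γ Y_{t+h}))]`. -/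
def feldTotalLog (h t : ℕ) : Ω → ℝ := fun ω =>
  Real.log (condLaplace μ 𝓕 Y Γ h t ω / Real.exp (-(Γ * Y (t + h) ω).trace))

/-- `log [Ψ(Γ, h-k | I_{t+k}) / Ψ(Γ, h-k-1 | I_{t+k+1})]`, used for `k < h`. -/
def feldTermLog (h k t : ℕ) : Ω → ℝ := fun ω =>
  Real.log (condLaplace μ 𝓕 Y Γ (h - k) (t + k) ω /
    condLaplace μ 𝓕 Y Γ (h - k - 1) (t + k + 1) ω)

/-- The left-hand side of the forecast error Laplace decomposition at date `t`. -/
def feldTotal (h t : ℕ) : Ω → ℝ := μ[feldTotalLog μ 𝓕 Y Γ h t | 𝓕 t]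

/-- The generic term of the forecast error Laplace decomposition at date `t`. -/
def feldTerm (h k t : ℕ) : Ω → ℝ := μ[feldTermLog μ 𝓕 Y Γ h k t | 𝓕 t]

end FELD

end

/-! Conditioning successively on later dates iterates the one-step transform, so the horizon-`h`
transform is again exponential-affine in `Y t`. Its argument and determinant obey the recursions
`warArg_succ` and `warDet_succ`, which follow from one factorization of `1 + 2 Σ_{h+1} Γ` and the
identities exchanging `1 + UV` with `1 + VU`.

Log Ψ is therefore affine in the current matrix, and the logarithms telescope. Taking conditional
expectations then requires only the conditional mean of `Tr (C Y_{t+k})`. That mean is not assumed: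
`IsWAR.condExp_trace_succ` recovers it, together with integrability, by differentiating the Laplace
transform of `s C` at `s = 0` along `s = 1/(k+1)`. Iterating gives `M^k Y_t (M^k)' + K Σ_k`, and
substitution yields the generic term. -/

noncomputable section

open Matrix Filter Topology

/-! ### Matrix algebra of the Laplace arguments and determinants. -/

section LinearAlgebra

variable {n : ℕ} {S Γ : Matrix (Fin n) (Fin n) ℝ}

/-- The map `Γ ↦ Γ (Id + 2 S Γ)⁻¹`. -/
def wishartArg (S Γ : Matrix (Fin n) (Fin n) ℝ) : Matrix (Fin n) (Fin n) ℝ :=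
  Γ * (1 + (2 : ℝ) • (S * Γ))⁻¹

open scoped MatrixOrder in
lemma exists_transpose_mul_self_of_posSemidef {A : Matrix (Fin n) (Fin n) ℝ} (hA : A.PosSemidef) :
    ∃ R : Matrix (Fin n) (Fin n) ℝ, A = Rᵀ * R := by
  obtain ⟨X, hX, -, h⟩ := CFC.exists_sqrt_of_isSelfAdjoint_of_quasispectrumRestricts hA.isHermitian
    (QuasispectrumRestricts.nnreal_of_nonneg hA.nonneg)
  have hX' : Xᵀ = X := by simpa [star_eq_conjTranspose] using hX.star_eq
  exact ⟨X, by rw [hX', h]⟩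

lemma Matrix.PosSemidef.transpose_eq_self {A : Matrix (Fin n) (Fin n) ℝ} (hA : A.PosSemidef) :
    Aᵀ = A := by simpa using hA.isHermitian.eq

lemma Matrix.PosSemidef.transpose_mul_mul {A : Matrix (Fin n) (Fin n) ℝ} (hA : A.PosSemidef)
    (B : Matrix (Fin n) (Fin n) ℝ) : (Bᵀ * A * B).PosSemidef := by
  simpa using hA.conjTranspose_mul_mul_same B

lemma Matrix.PosSemidef.mul_mul_transpose {A : Matrix (Fin n) (Fin n) ℝ} (hA : A.PosSemidef)
    (B : Matrix (Fin n) (Fin n) ℝ) : (B * A * Bᵀ).PosSemidef := by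
  simpa using hA.mul_mul_conjTranspose_same B

lemma Matrix.PosSemidef.trace_mul_nonneg {A B : Matrix (Fin n) (Fin n) ℝ} (hA : A.PosSemidef)
    (hB : B.PosSemidef) : 0 ≤ (A * B).trace := by
  obtain ⟨R, rfl⟩ := exists_transpose_mul_self_of_posSemidef hA
  rw [Matrix.mul_assoc, trace_mul_comm]
  exact (hB.mul_mul_transpose R).trace_nonneg

/-- With `S = Rᵀ R`, Sylvester's identity replaces the nonsymmetric `S Γ` by the positive
semi-definite `R Γ Rᵀ`. -/
lemma det_one_add_two_smul_mul_pos (hS : S.PosSemidef) (hΓ : Γ.PosSemidef) :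
    0 < (1 + (2 : ℝ) • (S * Γ)).det := by
  obtain ⟨R, rfl⟩ := exists_transpose_mul_self_of_posSemidef hS
  have h : (1 + (2 : ℝ) • (Rᵀ * R * Γ)).det = (1 + (2 : ℝ) • (R * Γ * Rᵀ)).det := by
    rw [Matrix.mul_assoc, ← Matrix.mul_smul, det_one_add_mul_comm, Matrix.smul_mul]
  rw [h]
  exact (PosDef.one.add_posSemidef ((hΓ.mul_mul_transpose R).smul zero_le_two)).det_pos

lemma wishartArg_mul_cancel (hS : S.PosSemidef) (hΓ : Γ.PosSemidef) :
    wishartArg S Γ * (1 + (2 : ℝ) • (S * Γ)) = Γ := by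
  rw [wishartArg, Matrix.mul_assoc, nonsing_inv_mul _ (det_one_add_two_smul_mul_pos hS hΓ).ne'.isUnit,
    Matrix.mul_one]

/-- With `P = 1 + 2 S Γ`, the matrix is the congruence by `P⁻¹` of `Pᵀ Γ = Γ + 2 Γ S Γ`. -/
lemma posSemidef_wishartArg (hS : S.PosSemidef) (hΓ : Γ.PosSemidef) :
    (wishartArg S Γ).PosSemidef := by
  set P := 1 + (2 : ℝ) • (S * Γ) with hP
  have hu : IsUnit P.det := (det_one_add_two_smul_mul_pos hS hΓ).ne'.isUnit
  have hPΓ : (Pᵀ * Γ).PosSemidef := by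
    have : Pᵀ * Γ = Γ + (2 : ℝ) • (Γᵀ * S * Γ) := by
      simp [hP, Matrix.add_mul, hS.transpose_eq_self]
    rw [this]
    exact hΓ.add ((hS.transpose_mul_mul Γ).smul zero_le_two)
  have : wishartArg S Γ = P⁻¹ᵀ * (Pᵀ * Γ) * P⁻¹ := by
    rw [← Matrix.mul_assoc, ← Matrix.transpose_mul, mul_nonsing_inv _ hu]
    simp [wishartArg, hP]
  rw [this]
  exact hPΓ.transpose_mul_mul _

lemma sub_wishartArg (hS : S.PosSemidef) (hΓ : Γ.PosSemidef) :
    Γ - wishartArg S Γ = (2 : ℝ) • (wishartArg S Γ * S * Γ) := by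
  rw [sub_eq_iff_eq_add]
  nth_rewrite 1 [← wishartArg_mul_cancel hS hΓ]
  simp [Matrix.mul_add, Matrix.mul_assoc, add_comm]

/-- Substituting `Γ = A + 2 Γ S A` into `Γ - A = 2 A S Γ` gives `2 A S A + 4 (S A)ᵀ Γ (S A)`. This
supplies the bound, uniform in `s`, used for domination. -/
lemma posSemidef_sub_wishartArg (hS : S.PosSemidef) (hΓ : Γ.PosSemidef) :
    (Γ - wishartArg S Γ).PosSemidef := by
  set A := wishartArg S Γ
  have hA' : A.PosSemidef := posSemidef_wishartArg hS hΓ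
  have h1 : Γ - A = (2 : ℝ) • (A * S * Γ) := sub_wishartArg hS hΓ
  have h2 : Γ - A = (2 : ℝ) • (Γ * S * A) := by
    have := congrArg Matrix.transpose h1
    simpa [hΓ.transpose_eq_self, hA'.transpose_eq_self, hS.transpose_eq_self,
      Matrix.mul_assoc] using this
  have h3 : Γ - A = (2 : ℝ) • (Aᵀ * S * A) + (4 : ℝ) • ((S * A)ᵀ * Γ * (S * A)) := by
    rw [transpose_mul, hA'.transpose_eq_self, hS.transpose_eq_self]
    calc Γ - A = (2 : ℝ) • (A * S * Γ) := h1
      _ = (2 : ℝ) • (A * S * (A + (2 : ℝ) • (Γ * S * A))) := by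
        rw [← h2, add_sub_cancel]
      _ = _ := by
        simp only [Matrix.mul_add, smul_add, Matrix.mul_smul, smul_smul, Matrix.mul_assoc]
        norm_num
  rw [h3]
  exact ((hS.transpose_mul_mul A).smul zero_le_two).add ((hΓ.transpose_mul_mul _).smul (by norm_num))

lemma posSemidef_warSigma (hS : S.PosSemidef) (M : Matrix (Fin n) (Fin n) ℝ) (m : ℕ) :
    (warSigma M S m).PosSemidef :=
  posSemidef_sum _ fun _ _ => hS.mul_mul_transpose _

lemma warSigma_succ (M S : Matrix (Fin n) (Fin n) ℝ) (m : ℕ) :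
    warSigma M S (m + 1) = warSigma M S m + M ^ m * S * (M ^ m)ᵀ :=
  Finset.sum_range_succ _ _

lemma warSigma_succ' (M S : Matrix (Fin n) (Fin n) ℝ) (m : ℕ) :
    warSigma M S (m + 1) = S + M * warSigma M S m * Mᵀ := by
  rw [warSigma, Finset.sum_range_succ', add_comm, warSigma, Matrix.mul_sum, Matrix.sum_mul]
  congr 1
  · simp
  · refine Finset.sum_congr rfl fun j _ => ?_
    simp [pow_succ', Matrix.mul_assoc]

/-- The argument of the conditional Laplace transform at horizon `h`. -/
def warArg (M S Γ : Matrix (Fin n) (Fin n) ℝ) (h : ℕ) : Matrix (Fin n) (Fin n) ℝ :=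
  (M ^ h)ᵀ * wishartArg (warSigma M S h) Γ * M ^ h

/-- The determinant in the conditional Laplace transform at horizon `h`. -/
def warDet (M S Γ : Matrix (Fin n) (Fin n) ℝ) (h : ℕ) : ℝ :=
  (1 + (2 : ℝ) • (warSigma M S h * Γ)).det

lemma warDet_pos (hS : S.PosSemidef) (hΓ : Γ.PosSemidef) (M : Matrix (Fin n) (Fin n) ℝ) (h : ℕ) :
    0 < warDet M S Γ h :=
  det_one_add_two_smul_mul_pos (posSemidef_warSigma hS M h) hΓ

lemma posSemidef_warArg (hS : S.PosSemidef) (hΓ : Γ.PosSemidef) (M : Matrix (Fin n) (Fin n) ℝ)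
    (h : ℕ) : (warArg M S Γ h).PosSemidef :=
  (posSemidef_wishartArg (posSemidef_warSigma hS M h) hΓ).transpose_mul_mul _

@[simp] lemma warArg_zero (M S Γ : Matrix (Fin n) (Fin n) ℝ) : warArg M S Γ 0 = Γ := by
  simp [warArg, wishartArg, warSigma]

@[simp] lemma warDet_zero (M S Γ : Matrix (Fin n) (Fin n) ℝ) : warDet M S Γ 0 = 1 := by
  simp [warDet, warSigma]

/-- The term added to `Σ_h` contains `Γ`, which is written as `A (1 + 2 Σ_h Γ)` so that this factor
comes out on the right. -/
lemma one_add_warSigma_succ (hS : S.PosSemidef) (hΓ : Γ.PosSemidef)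
    (M : Matrix (Fin n) (Fin n) ℝ) (h : ℕ) :
    1 + (2 : ℝ) • (warSigma M S (h + 1) * Γ) =
      (1 + M ^ h * ((2 : ℝ) • (S * (M ^ h)ᵀ * wishartArg (warSigma M S h) Γ))) *
        (1 + (2 : ℝ) • (warSigma M S h * Γ)) := by
  rw [Matrix.add_mul 1, Matrix.one_mul, Matrix.mul_smul, Matrix.smul_mul, Matrix.mul_assoc (M ^ h),
    Matrix.mul_assoc (S * _), wishartArg_mul_cancel (posSemidef_warSigma hS M h) hΓ, warSigma_succ]
  simp [Matrix.add_mul, add_assoc, Matrix.mul_assoc]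

lemma one_add_two_smul_mul_warArg (M S Γ : Matrix (Fin n) (Fin n) ℝ) (h : ℕ) :
    1 + (2 : ℝ) • (S * warArg M S Γ h) =
      1 + (2 : ℝ) • (S * (M ^ h)ᵀ * wishartArg (warSigma M S h) Γ) * M ^ h := by
  simp [warArg, Matrix.mul_assoc]

lemma warDet_succ (hS : S.PosSemidef) (hΓ : Γ.PosSemidef) (M : Matrix (Fin n) (Fin n) ℝ) (h : ℕ) :
    warDet M S Γ (h + 1) = (1 + (2 : ℝ) • (S * warArg M S Γ h)).det * warDet M S Γ h := by
  rw [warDet, one_add_warSigma_succ hS hΓ, det_mul, det_one_add_mul_comm,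
    one_add_two_smul_mul_warArg, warDet]

/-- The factorization gives `A_{h+1} = A (1 + UV)⁻¹`; pushing `U = M^h` through the inverse turns `1
+ UV` into `1 + VU`, which is `1 + 2 S (warArg M S Γ h)`. -/
lemma warArg_succ (hS : S.PosSemidef) (hΓ : Γ.PosSemidef) (M : Matrix (Fin n) (Fin n) ℝ) (h : ℕ) :
    warArg M S Γ (h + 1) = Mᵀ * wishartArg S (warArg M S Γ h) * M := by
  set A := wishartArg (warSigma M S h) Γ with hA
  set U := M ^ h with hU
  set V := (2 : ℝ) • (S * Uᵀ * A) with hV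
  have hVU : IsUnit (1 + V * U).det := by
    rw [hV, hU, hA, ← one_add_two_smul_mul_warArg]
    exact (det_one_add_two_smul_mul_pos hS (posSemidef_warArg hS hΓ M h)).ne'.isUnit
  have hUV : IsUnit (1 + U * V).det := by rwa [det_one_add_mul_comm]
  have hA1 : wishartArg (warSigma M S (h + 1)) Γ = A * (1 + U * V)⁻¹ := by
    rw [wishartArg, one_add_warSigma_succ hS hΓ, Matrix.mul_inv_rev, ← Matrix.mul_assoc]
    rfl
  have hcomm : (1 + U * V)⁻¹ * U = U * (1 + V * U)⁻¹ := by
    have : U * (1 + V * U) = (1 + U * V) * U := by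
      simp [Matrix.mul_add, Matrix.add_mul, Matrix.mul_assoc]
    calc (1 + U * V)⁻¹ * U = (1 + U * V)⁻¹ * (U * (1 + V * U)) * (1 + V * U)⁻¹ := by
          rw [Matrix.mul_assoc, Matrix.mul_assoc U, mul_nonsing_inv _ hVU, Matrix.mul_one]
      _ = _ := by rw [this, ← Matrix.mul_assoc, nonsing_inv_mul _ hUV, Matrix.one_mul]
  have hB : wishartArg S (warArg M S Γ h) = Uᵀ * A * (U * (1 + V * U)⁻¹) := by
    rw [wishartArg, one_add_two_smul_mul_warArg, warArg, Matrix.mul_assoc _ (M ^ h)]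
  rw [hB, ← hcomm, warArg, hA1, pow_succ, transpose_mul]
  simp only [Matrix.mul_assoc, ← hU]

/-- Moving `s` from the argument to `S` makes division by `s` exact, leaving a factor continuous at
`s = 0`. -/
lemma wishartArg_smul (s : ℝ) (S C : Matrix (Fin n) (Fin n) ℝ) :
    wishartArg S (s • C) = s • wishartArg (s • S) C := by
  simp [wishartArg]

lemma tendsto_wishartArg_smul (S C : Matrix (Fin n) (Fin n) ℝ) :
    Tendsto (fun s : ℝ => wishartArg (s • S) C) (𝓝 0) (𝓝 C) := by
  have hc : ContinuousAt (fun s : ℝ => wishartArg (s • S) C) 0 := by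
    refine ContinuousAt.mul continuousAt_const ?_
    refine ContinuousAt.comp (g := Inv.inv) (continuousAt_matrix_inv _ ?_) (by fun_prop)
    simp only [Ring.inverse_eq_inv']
    exact continuousAt_inv₀ (by simp)
  simpa [ContinuousAt, wishartArg] using hc

/-- The determinant is a polynomial in `s` whose linear coefficient is the trace. -/
lemma hasDerivAt_det_one_add_smul (N : Matrix (Fin n) (Fin n) ℝ) :
    HasDerivAt (fun s : ℝ => (1 + s • N).det) N.trace 0 := by
  have h := (det (1 + (Polynomial.X : Polynomial ℝ) • N.map Polynomial.C)).hasDerivAt 0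
  rw [derivative_det_one_add_X_smul] at h
  refine h.congr_of_eventuallyEq (Eventually.of_forall fun s => ?_)
  dsimp only
  rw [← Polynomial.coe_evalRingHom, RingHom.map_det]
  congr 1
  ext i j
  by_cases hij : i = j <;> simp [hij, mul_comm (N _ _)]

lemma hasDerivAt_log_det_one_add_smul (N : Matrix (Fin n) (Fin n) ℝ) :
    HasDerivAt (fun s : ℝ => Real.log (1 + s • N).det) N.trace 0 := by
  simpa using (hasDerivAt_det_one_add_smul N).log (by simp)

end LinearAlgebra

/-! ### Conditional means from the Laplace transform near the origin. -/

section Moment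

/-- The direction `z k` may vary because the Laplace exponent divided by `s` itself depends on `s`.
-/
lemma tendsto_natCast_add_one_mul_of_hasDerivAt {f : ℝ → ℝ} {f' : ℝ} (hf : HasDerivAt f f' 0)
    {z : ℕ → ℝ} {c : ℝ} (hz : Tendsto z atTop (𝓝 c)) :
    Tendsto (fun k : ℕ => ((k : ℝ) + 1) * (f (((k : ℝ) + 1)⁻¹ * z k) - f 0)) atTop
      (𝓝 (c * f')) := by
  have h0 : Tendsto (fun k : ℕ => ((k : ℝ) + 1)⁻¹ * z k) atTop (𝓝 0) := by
    simpa [one_div] using tendsto_one_div_add_atTop_nhds_zero_nat.mul hz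
  have h1 : Tendsto (fun k : ℕ => ((k : ℝ) + 1) • (((k : ℝ) + 1)⁻¹ * z k)) atTop (𝓝 c) := by
    refine hz.congr fun k => ?_
    have : ((k : ℝ) + 1) ≠ 0 := by positivity
    simp [this]
  simpa using hf.hasFDerivAt.hasFDerivWithinAt.lim (s := Set.univ) h0 (by simp) h1

lemma tendsto_natCast_add_one_mul_one_sub_exp {z : ℕ → ℝ} {c : ℝ} (hz : Tendsto z atTop (𝓝 c)) :
    Tendsto (fun k : ℕ => ((k : ℝ) + 1) * (1 - Real.exp (-(((k : ℝ) + 1)⁻¹ * z k)))) atTop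
      (𝓝 c) := by
  have hf : HasDerivAt (fun x : ℝ => 1 - Real.exp (-x)) 1 0 := by
    simpa using ((hasDerivAt_neg (0 : ℝ)).exp).const_sub 1
  simpa using tendsto_natCast_add_one_mul_of_hasDerivAt hf hz

lemma natCast_add_one_mul_one_sub_exp_le (k : ℕ) (x : ℝ) :
    ((k : ℝ) + 1) * (1 - Real.exp (-(((k : ℝ) + 1)⁻¹ * x))) ≤ x := by
  have hk : (0 : ℝ) < (k : ℝ) + 1 := by positivity
  have h := Real.add_one_le_exp (-(((k : ℝ) + 1)⁻¹ * x))
  calc ((k : ℝ) + 1) * (1 - Real.exp (-(((k : ℝ) + 1)⁻¹ * x)))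
      ≤ ((k : ℝ) + 1) * (((k : ℝ) + 1)⁻¹ * x) := by gcongr; linarith
    _ = x := by field_simp

lemma natCast_add_one_mul_one_sub_exp_nonneg (k : ℕ) {x : ℝ} (hx : 0 ≤ x) :
    0 ≤ ((k : ℝ) + 1) * (1 - Real.exp (-(((k : ℝ) + 1)⁻¹ * x))) := by
  have : Real.exp (-(((k : ℝ) + 1)⁻¹ * x)) ≤ 1 := Real.exp_le_one_iff.2 (by
    have : 0 ≤ ((k : ℝ) + 1)⁻¹ * x := by positivity
    linarith)
  have h2 : 0 ≤ 1 - Real.exp (-(((k : ℝ) + 1)⁻¹ * x)) := by linarith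
  positivity

variable {Ω : Type*} {mΩ : MeasurableSpace Ω} {μ : Measure Ω} [IsProbabilityMeasure μ]
    {𝓕 : Filtration ℕ mΩ} {n : ℕ} {K : ℝ} {M S : Matrix (Fin n) (Fin n) ℝ}
    {Y : ℕ → Ω → Matrix (Fin n) (Fin n) ℝ}

omit [IsProbabilityMeasure μ] in
lemma IsWAR.stronglyMeasurable_trace (hY : IsWAR μ 𝓕 K M S Y) (C : Matrix (Fin n) (Fin n) ℝ)
    (t : ℕ) : StronglyMeasurable[𝓕 t] fun ω => (C * Y t ω).trace := by
  simp only [trace, diag_apply, mul_apply]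
  exact Finset.stronglyMeasurable_fun_sum _ fun i _ => Finset.stronglyMeasurable_fun_sum _
    fun j _ => (hY.adapted t j i).const_mul _

omit [IsProbabilityMeasure μ] in
lemma IsWAR.trace_nonneg (hY : IsWAR μ 𝓕 K M S Y) {C : Matrix (Fin n) (Fin n) ℝ}
    (hC : C.PosSemidef) (t : ℕ) : ∀ᵐ ω ∂μ, 0 ≤ (C * Y t ω).trace := by
  filter_upwards [hY.posSemidef t] with ω hω using hC.trace_mul_nonneg hω

lemma IsWAR.integrable_exp (hY : IsWAR μ 𝓕 K M S Y) {C : Matrix (Fin n) (Fin n) ℝ}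
    (hC : C.PosSemidef) (t : ℕ) : Integrable (fun ω => Real.exp (-(C * Y t ω).trace)) μ := by
  refine Integrable.of_bound (C := 1) ?_ ?_
  · exact (Real.continuous_exp.comp_stronglyMeasurable
      ((hY.stronglyMeasurable_trace C t).mono (𝓕.le t)).neg).aestronglyMeasurable
  · filter_upwards [hY.trace_nonneg hC t] with ω hω
    rw [Real.norm_eq_abs, Real.abs_exp]
    exact Real.exp_le_one_iff.2 (by linarith)

/-- The Laplace exponent of the argument `s C`, divided by `s`, for `s = 1 / (k + 1)`. -/
def laplaceQuotient (K : ℝ) (M S C : Matrix (Fin n) (Fin n) ℝ) (k : ℕ)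
    (y : Matrix (Fin n) (Fin n) ℝ) : ℝ :=
  (Mᵀ * wishartArg (((k : ℝ) + 1)⁻¹ • S) C * M * y).trace +
    K / 2 * (((k : ℝ) + 1) * Real.log (1 + ((k : ℝ) + 1)⁻¹ • ((2 : ℝ) • (S * C))).det)

lemma tendsto_mul_log_det (S C : Matrix (Fin n) (Fin n) ℝ) :
    Tendsto (fun k : ℕ => ((k : ℝ) + 1) *
      Real.log (1 + ((k : ℝ) + 1)⁻¹ • ((2 : ℝ) • (S * C))).det) atTop (𝓝 (2 * (S * C).trace)) := by
  simpa using tendsto_natCast_add_one_mul_of_hasDerivAt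
    (hasDerivAt_log_det_one_add_smul ((2 : ℝ) • (S * C)))
    (tendsto_const_nhds (x := (1 : ℝ)))

lemma tendsto_laplaceQuotient (K : ℝ) (M S C y : Matrix (Fin n) (Fin n) ℝ) :
    Tendsto (fun k => laplaceQuotient K M S C k y) atTop
      (𝓝 ((Mᵀ * C * M * y).trace + K * (S * C).trace)) := by
  have h0 : Tendsto (fun k : ℕ => ((k : ℝ) + 1)⁻¹) atTop (𝓝 0) := by
    simpa [one_div] using tendsto_one_div_add_atTop_nhds_zero_nat (𝕜 := ℝ)
  have h1 := (tendsto_wishartArg_smul S C).comp h0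
  have hc : Continuous fun A : Matrix (Fin n) (Fin n) ℝ => (Mᵀ * A * M * y).trace := by fun_prop
  have h2 := ((hc.tendsto C).comp h1).add ((tendsto_mul_log_det S C).const_mul (K / 2))
  rw [← mul_assoc, div_mul_cancel₀ K two_ne_zero] at h2
  exact h2

/-- The trace part is dominated since `wishartArg (s • S) C ≤ C`; the determinant part is a
convergent sequence, hence bounded whatever the sign of `K`. -/
lemma exists_laplaceQuotient_le (K : ℝ) (M : Matrix (Fin n) (Fin n) ℝ)
    {S C : Matrix (Fin n) (Fin n) ℝ} (hS : S.PosSemidef) (hC : C.PosSemidef) :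
    ∃ L : ℝ, ∀ k, ∀ y : Matrix (Fin n) (Fin n) ℝ, y.PosSemidef →
      laplaceQuotient K M S C k y ≤ (Mᵀ * C * M * y).trace + L := by
  obtain ⟨L, hL⟩ := ((tendsto_mul_log_det S C).const_mul (K / 2)).bddAbove_range
  refine ⟨L, fun k y hy => add_le_add ?_ (hL ⟨k, rfl⟩)⟩
  have hs : (0 : ℝ) ≤ ((k : ℝ) + 1)⁻¹ := by positivity
  have h := ((posSemidef_sub_wishartArg (hS.smul hs) hC).transpose_mul_mul M).trace_mul_nonneg hy
  rw [Matrix.mul_sub, Matrix.sub_mul, Matrix.sub_mul, trace_sub] at h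
  linarith

lemma IsWAR.condExp_one_sub_exp (hY : IsWAR μ 𝓕 K M S Y) {C : Matrix (Fin n) (Fin n) ℝ}
    (hC : C.PosSemidef) (t k : ℕ) :
    μ[fun ω => ((k : ℝ) + 1) * (1 - Real.exp (-(((k : ℝ) + 1)⁻¹ * (C * Y (t + 1) ω).trace))) | 𝓕 t]
      =ᵐ[μ] fun ω => ((k : ℝ) + 1) *
        (1 - Real.exp (-(((k : ℝ) + 1)⁻¹ * laplaceQuotient K M S C k (Y t ω)))) := by
  set s : ℝ := ((k : ℝ) + 1)⁻¹ with hs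
  have hk : (0 : ℝ) < (k : ℝ) + 1 := by positivity
  have hs0 : 0 ≤ s := by positivity
  have hsk : s * ((k : ℝ) + 1) = 1 := by rw [hs]; field_simp
  have hsC : (s • C).PosSemidef := hC.smul hs0
  have hi := hY.integrable_exp hsC (t + 1)
  have hd := det_one_add_two_smul_mul_pos hY.posSemidef_innovation hsC
  have hd' : 1 + (2 : ℝ) • (S * s • C) = 1 + s • ((2 : ℝ) • (S * C)) := by
    rw [Matrix.mul_smul, smul_comm]
  have h1 : (fun ω => ((k : ℝ) + 1) * (1 - Real.exp (-(s * (C * Y (t + 1) ω).trace)))) =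
      ((k : ℝ) + 1) • ((fun _ => (1 : ℝ)) - fun ω => Real.exp (-((s • C) * Y (t + 1) ω).trace)) := by
    funext ω
    simp
  rw [h1]
  filter_upwards [condExp_smul (μ := μ) ((k : ℝ) + 1) ((fun _ => (1 : ℝ)) -
    fun ω => Real.exp (-((s • C) * Y (t + 1) ω).trace)) (𝓕 t),
    condExp_sub (integrable_const (1 : ℝ)) hi (𝓕 t), hY.laplace t (s • C) hsC] with ω e1 e2 e3
  rw [e1, Pi.smul_apply, e2, Pi.sub_apply, e3, condExp_const (𝓕.le t), smul_eq_mul]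
  congr 2
  change Real.exp (-(Mᵀ * wishartArg S (s • C) * M * Y t ω).trace) / _ = _
  rw [Real.rpow_def_of_pos hd, ← Real.exp_sub, laplaceQuotient, wishartArg_smul, hd', ← hs]
  congr 1
  simp only [Matrix.mul_smul, Matrix.smul_mul, trace_smul, smul_eq_mul]
  linear_combination (-(K / 2) * Real.log (1 + s • ((2 : ℝ) • (S * C))).det) * (-hsk)

/-- The quotients `(1 - exp (-s X)) / s` are bounded by `X` and tend to it, while their conditional
expectations are explicit and dominated by an affine function of `Y t`. Fatou gives integrability of
`X`, then dominated convergence identifies its conditional mean. -/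
lemma IsWAR.condExp_trace_succ (hY : IsWAR μ 𝓕 K M S Y) {t : ℕ}
    (hint : ∀ C : Matrix (Fin n) (Fin n) ℝ, C.PosSemidef →
      Integrable (fun ω => (C * Y t ω).trace) μ)
    {C : Matrix (Fin n) (Fin n) ℝ} (hC : C.PosSemidef) :
    Integrable (fun ω => (C * Y (t + 1) ω).trace) μ ∧
      μ[fun ω => (C * Y (t + 1) ω).trace | 𝓕 t] =ᵐ[μ] fun ω =>
        (Mᵀ * C * M * Y t ω).trace + K * (S * C).trace := by
  set X : Ω → ℝ := fun ω => (C * Y (t + 1) ω).trace with hXdef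
  have hX0 : ∀ᵐ ω ∂μ, 0 ≤ X ω := hY.trace_nonneg hC (t + 1)
  have hXm : StronglyMeasurable X := (hY.stronglyMeasurable_trace C (t + 1)).mono (𝓕.le _)
  set f : ℕ → Ω → ℝ := fun k ω =>
    ((k : ℝ) + 1) * (1 - Real.exp (-(((k : ℝ) + 1)⁻¹ * X ω))) with hf
  set g : ℕ → Ω → ℝ := fun k ω =>
    ((k : ℝ) + 1) * (1 - Real.exp (-(((k : ℝ) + 1)⁻¹ * laplaceQuotient K M S C k (Y t ω)))) with hg
  have hfg : ∀ k, μ[f k | 𝓕 t] =ᵐ[μ] g k := hY.condExp_one_sub_exp hC t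
  obtain ⟨L, hL⟩ := exists_laplaceQuotient_le K M hY.posSemidef_innovation hC
  have hG : Integrable (fun ω => (Mᵀ * C * M * Y t ω).trace + L) μ :=
    (hint _ (hC.transpose_mul_mul M)).add (integrable_const L)
  have hf0 : ∀ k, 0 ≤ᵐ[μ] f k := fun k => by
    filter_upwards [hX0] with ω hω using natCast_add_one_mul_one_sub_exp_nonneg k hω
  -- As `K` may be negative, the sign is not read off the formula for `g` but inherited from `f`
  -- through conditioning.
  have hg0 : ∀ k, 0 ≤ᵐ[μ] g k := fun k => by
    filter_upwards [condExp_nonneg (m := 𝓕 t) (hf0 k), hfg k] with ω h1 h2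
    rwa [h2] at h1
  have hgG : ∀ k, ∀ᵐ ω ∂μ, g k ω ≤ (Mᵀ * C * M * Y t ω).trace + L := fun k => by
    filter_upwards [hY.posSemidef t] with ω hω
    exact (natCast_add_one_mul_one_sub_exp_le k _).trans (hL k _ hω)
  have hfm : ∀ k, StronglyMeasurable (f k) := fun k => by
    have : Continuous fun x : ℝ => ((k : ℝ) + 1) * (1 - Real.exp (-(((k : ℝ) + 1)⁻¹ * x))) := by
      fun_prop
    exact this.comp_stronglyMeasurable hXm
  have hfi : ∀ k, Integrable (f k) μ := fun k => by
    refine Integrable.of_bound (hfm k).aestronglyMeasurable ((k : ℝ) + 1) ?_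
    filter_upwards [hf0 k] with ω hω
    rw [Real.norm_of_nonneg hω]
    have := Real.exp_pos (-(((k : ℝ) + 1)⁻¹ * X ω))
    exact mul_le_of_le_one_right (by positivity) (by linarith)
  have hgi : ∀ k, Integrable (g k) μ := fun k => integrable_condExp.congr (hfg k)
  have hfX : ∀ᵐ ω ∂μ, Tendsto (fun k => f k ω) atTop (𝓝 (X ω)) :=
    Eventually.of_forall fun ω => tendsto_natCast_add_one_mul_one_sub_exp tendsto_const_nhds
  have hXi : Integrable X μ := by
    refine ⟨hXm.aestronglyMeasurable, ?_⟩
    -- `f k` and `g k` have the same integral, so the dominating function of `g` bounds the `L¹`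
    -- norms of `f` uniformly, as Fatou requires.
    have hbd : ∀ k, ∫⁻ ω, ‖f k ω‖ₑ ∂μ ≤
        ENNReal.ofReal (∫ ω, ((Mᵀ * C * M * Y t ω).trace + L) ∂μ) := fun k => by
      rw [← ofReal_integral_norm_eq_lintegral_enorm (hfi k)]
      refine ENNReal.ofReal_le_ofReal ?_
      calc ∫ ω, ‖f k ω‖ ∂μ = ∫ ω, f k ω ∂μ := integral_congr_ae (by
            filter_upwards [hf0 k] with ω hω using Real.norm_of_nonneg hω)
        _ = ∫ ω, g k ω ∂μ := by
            rw [← integral_condExp (𝓕.le t), integral_congr_ae (hfg k)]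
        _ ≤ _ := integral_mono_ae (hgi k) hG (hgG k)
    have hlim : ∫⁻ ω, ‖X ω‖ₑ ∂μ = ∫⁻ ω, liminf (fun k => ‖f k ω‖ₑ) atTop ∂μ := by
      refine lintegral_congr_ae ?_
      filter_upwards [hfX] with ω hω using hω.enorm.liminf_eq.symm
    refine (hlim.trans_le (lintegral_liminf_le' fun k =>
      (hfm k).aestronglyMeasurable.aemeasurable.enorm)).trans_lt ?_
    exact (liminf_le_of_le (by isBoundedDefault) fun b hb =>
      (hb.exists.choose_spec.trans (hbd _))).trans_lt ENNReal.ofReal_lt_top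
  refine ⟨hXi, ?_⟩
  -- Dominated convergence on both sides: `f k` under `X`, now known integrable, and `g k` under the
  -- affine bound. Their conditional expectations agree by idempotence.
  have key := tendsto_condExp_unique (m := 𝓕 t) f g X
    (fun ω => (Mᵀ * C * M * Y t ω).trace + K * (S * C).trace) hfi hgi hfX
    (Eventually.of_forall fun ω =>
      tendsto_natCast_add_one_mul_one_sub_exp (tendsto_laplaceQuotient K M S C (Y t ω)))
    X hXi _ hG
    (fun k => by
      filter_upwards [hf0 k] with ω hω
      rw [Real.norm_of_nonneg hω]
      exact natCast_add_one_mul_one_sub_exp_le k _)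
    (fun k => by
      filter_upwards [hg0 k, hgG k] with ω hω h
      rwa [Real.norm_of_nonneg hω])
    (fun k => (hfg k).trans <| ((condExp_congr_ae (hfg k)).symm.trans
      (condExp_condExp_of_le le_rfl (𝓕.le t))).trans (hfg k) |>.symm)
  have hlm : StronglyMeasurable[𝓕 t] fun ω => (Mᵀ * C * M * Y t ω).trace + K * (S * C).trace :=
    (hY.stronglyMeasurable_trace _ t).add stronglyMeasurable_const
  have hli : Integrable (fun ω => (Mᵀ * C * M * Y t ω).trace + K * (S * C).trace) μ :=
    (hint _ (hC.transpose_mul_mul M)).add (integrable_const _)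
  rwa [condExp_of_stronglyMeasurable (𝓕.le t) hlm hli] at key

lemma IsWAR.integrable_trace_add (hY : IsWAR μ 𝓕 K M S Y) {t : ℕ}
    (hint : ∀ C : Matrix (Fin n) (Fin n) ℝ, C.PosSemidef →
      Integrable (fun ω => (C * Y t ω).trace) μ) (k : ℕ)
    {C : Matrix (Fin n) (Fin n) ℝ} (hC : C.PosSemidef) :
    Integrable (fun ω => (C * Y (t + k) ω).trace) μ := by
  induction k generalizing C with
  | zero => exact hint C hC
  | succ k ih => exact (hY.condExp_trace_succ (fun C hC => ih hC) hC).1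

/-- The conditional mean at horizon `k` is `M^k Y_t (M^k)' + K Σ_k`. -/
lemma IsWAR.condExp_trace_add (hY : IsWAR μ 𝓕 K M S Y) {t : ℕ}
    (hint : ∀ C : Matrix (Fin n) (Fin n) ℝ, C.PosSemidef →
      Integrable (fun ω => (C * Y t ω).trace) μ) (k : ℕ)
    {C : Matrix (Fin n) (Fin n) ℝ} (hC : C.PosSemidef) :
    μ[fun ω => (C * Y (t + k) ω).trace | 𝓕 t] =ᵐ[μ] fun ω =>
      ((M ^ k)ᵀ * C * M ^ k * Y t ω).trace + K * (C * warSigma M S k).trace := by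
  induction k generalizing C with
  | zero =>
    refine EventuallyEq.of_eq ?_
    rw [add_zero, condExp_of_stronglyMeasurable (𝓕.le t) (hY.stronglyMeasurable_trace C t)
      (hint C hC)]
    simp [warSigma]
  | succ k ih =>
    have hi : ∀ C : Matrix (Fin n) (Fin n) ℝ, C.PosSemidef →
      Integrable (fun ω => (C * Y (t + k) ω).trace) μ := fun C hC =>
        hY.integrable_trace_add hint k hC
    have hC' := hC.transpose_mul_mul M
    -- Conditioning first at `t + k` replaces `C` by `Mᵀ C M`; the constant `K Tr (S C)` completes
    -- `Σ_{k+1} = S + M Σ_k Mᵀ`.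
    have h1 := (condExp_condExp_of_le (f := fun ω => (C * Y (t + k + 1) ω).trace)
      (𝓕.mono (Nat.le_add_right t k)) (𝓕.le (t + k))).symm.trans
      (condExp_congr_ae (hY.condExp_trace_succ hi hC).2)
    have h2 := condExp_add (hi _ hC') (integrable_const (μ := μ) (K * (S * C).trace)) (𝓕 t)
    filter_upwards [h1, h2, ih hC'] with ω e1 e2 e3
    refine e1.trans (e2.trans ?_)
    rw [Pi.add_apply, e3, condExp_const (𝓕.le t), warSigma_succ', Matrix.mul_add, trace_add,
      pow_succ', transpose_mul, trace_mul_comm S C, ← Matrix.mul_assoc C, ← Matrix.mul_assoc C,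
      trace_mul_comm _ Mᵀ]
    simp only [Matrix.mul_assoc]
    ring

end Moment

/-! ### Transforms at every horizon and the telescoping of their logarithms. -/

section Decomposition

variable {Ω : Type*} {mΩ : MeasurableSpace Ω} {μ : Measure Ω} [IsProbabilityMeasure μ]
    {𝓕 : Filtration ℕ mΩ} {n : ℕ} {K : ℝ} {M S Γ : Matrix (Fin n) (Fin n) ℝ}
    {Y : ℕ → Ω → Matrix (Fin n) (Fin n) ℝ}

lemma IsWAR.condLaplace_eq (hY : IsWAR μ 𝓕 K M S Y) (hΓ : Γ.PosSemidef) (h t : ℕ) :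
    condLaplace μ 𝓕 Y Γ h t =ᵐ[μ] fun ω =>
      Real.exp (-(warArg M S Γ h * Y t ω).trace) / warDet M S Γ h ^ (K / 2) := by
  have hS := hY.posSemidef_innovation
  induction h generalizing t with
  | zero =>
    refine EventuallyEq.of_eq ?_
    have hm : StronglyMeasurable[𝓕 t] fun ω => Real.exp (-(Γ * Y t ω).trace) :=
      Real.continuous_exp.comp_stronglyMeasurable (hY.stronglyMeasurable_trace Γ t).neg
    rw [condLaplace, add_zero,
      condExp_of_stronglyMeasurable (𝓕.le t) hm (hY.integrable_exp hΓ t)]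
    simp
  | succ h ih =>
    have hA := posSemidef_warArg hS hΓ M h
    -- Conditioning first at `t + 1` leaves the one-step transform to be applied last, at the
    -- argument `warArg M S Γ h`.
    have h1 : condLaplace μ 𝓕 Y Γ (h + 1) t =ᵐ[μ] μ[condLaplace μ 𝓕 Y Γ h (t + 1) | 𝓕 t] := by
      rw [condLaplace, condLaplace, show t + (h + 1) = t + 1 + h by ring]
      exact (condExp_condExp_of_le (𝓕.mono (Nat.le_succ t)) (𝓕.le (t + 1))).symm
    have h2 := h1.trans (condExp_congr_ae (ih (t + 1)))
    have h3 : (fun ω => Real.exp (-(warArg M S Γ h * Y (t + 1) ω).trace) /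
        warDet M S Γ h ^ (K / 2)) = (warDet M S Γ h ^ (K / 2))⁻¹ •
          fun ω => Real.exp (-(warArg M S Γ h * Y (t + 1) ω).trace) := by
      funext ω
      simp [div_eq_inv_mul]
    rw [h3] at h2
    filter_upwards [h2, condExp_smul (μ := μ) (warDet M S Γ h ^ (K / 2))⁻¹
      (fun ω => Real.exp (-(warArg M S Γ h * Y (t + 1) ω).trace)) (𝓕 t),
      hY.laplace t _ hA] with ω e1 e2 e3
    rw [e1, e2, Pi.smul_apply, e3, warArg_succ hS hΓ, warDet_succ hS hΓ,
      Real.mul_rpow (det_one_add_two_smul_mul_pos hS hA).le (warDet_pos hS hΓ M h).le,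
      smul_eq_mul, ← div_eq_inv_mul, div_div]
    rfl

/-- The logarithm of the conditional Laplace transform at horizon `h`, in terms of `Y_t = y`. -/
def logLaplace (K : ℝ) (M S Γ : Matrix (Fin n) (Fin n) ℝ) (h : ℕ)
    (y : Matrix (Fin n) (Fin n) ℝ) : ℝ :=
  -(warArg M S Γ h * y).trace - K / 2 * Real.log (warDet M S Γ h)

lemma IsWAR.condLaplace_eq_exp (hY : IsWAR μ 𝓕 K M S Y) (hΓ : Γ.PosSemidef) (h t : ℕ) :
    condLaplace μ 𝓕 Y Γ h t =ᵐ[μ] fun ω => Real.exp (logLaplace K M S Γ h (Y t ω)) := by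
  filter_upwards [hY.condLaplace_eq hΓ h t] with ω hω
  rw [hω, logLaplace, Real.exp_sub, Real.rpow_def_of_pos (warDet_pos hY.posSemidef_innovation hΓ M h),
    mul_comm (Real.log _)]

lemma IsWAR.feldTotalLog_eq (hY : IsWAR μ 𝓕 K M S Y) (hΓ : Γ.PosSemidef) (h t : ℕ) :
    feldTotalLog μ 𝓕 Y Γ h t =ᵐ[μ] fun ω =>
      logLaplace K M S Γ h (Y t ω) - logLaplace K M S Γ 0 (Y (t + h) ω) := by
  filter_upwards [hY.condLaplace_eq_exp hΓ h t] with ω hω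
  rw [feldTotalLog, hω, ← Real.exp_sub, Real.log_exp]
  simp [logLaplace]

lemma IsWAR.feldTermLog_eq (hY : IsWAR μ 𝓕 K M S Y) (hΓ : Γ.PosSemidef) (h k t : ℕ) :
    feldTermLog μ 𝓕 Y Γ h k t =ᵐ[μ] fun ω =>
      logLaplace K M S Γ (h - k) (Y (t + k) ω) -
        logLaplace K M S Γ (h - k - 1) (Y (t + k + 1) ω) := by
  filter_upwards [hY.condLaplace_eq_exp hΓ (h - k) (t + k),
    hY.condLaplace_eq_exp hΓ (h - k - 1) (t + k + 1)] with ω h1 h2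
  rw [feldTermLog, h1, h2, ← Real.exp_sub, Real.log_exp]

/-- The telescoping of the logarithms behind the decomposition. -/
lemma IsWAR.feldTotalLog_eq_sum (hY : IsWAR μ 𝓕 K M S Y) (hΓ : Γ.PosSemidef) (h t : ℕ) :
    feldTotalLog μ 𝓕 Y Γ h t =ᵐ[μ] ∑ k ∈ Finset.range h, feldTermLog μ 𝓕 Y Γ h k t := by
  filter_upwards [hY.feldTotalLog_eq hΓ h t, ae_all_iff.2 fun k => hY.feldTermLog_eq hΓ h k t]
    with ω h1 h2
  rw [h1, Finset.sum_apply, Finset.sum_congr rfl fun k _ => h2 k]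
  -- The endpoint `k = h` has horizon `0`, where `logLaplace` is `-Tr (Γ Y_{t+h})`.
  have := Finset.sum_range_sub' (fun k => logLaplace K M S Γ (h - k) (Y (t + k) ω)) h
  simpa [Nat.sub_sub, add_assoc] using this.symm

lemma IsWAR.integrable_logLaplace (hY : IsWAR μ 𝓕 K M S Y) (hΓ : Γ.PosSemidef) {t : ℕ}
    (hint : ∀ C : Matrix (Fin n) (Fin n) ℝ, C.PosSemidef →
      Integrable (fun ω => (C * Y t ω).trace) μ) (h k : ℕ) :
    Integrable (fun ω => logLaplace K M S Γ h (Y (t + k) ω)) μ :=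
  (hY.integrable_trace_add hint k
    (posSemidef_warArg hY.posSemidef_innovation hΓ M h)).neg.sub (integrable_const _)

lemma IsWAR.condExp_logLaplace (hY : IsWAR μ 𝓕 K M S Y) (hΓ : Γ.PosSemidef) {t : ℕ}
    (hint : ∀ C : Matrix (Fin n) (Fin n) ℝ, C.PosSemidef →
      Integrable (fun ω => (C * Y t ω).trace) μ) (h k : ℕ) :
    μ[fun ω => logLaplace K M S Γ h (Y (t + k) ω) | 𝓕 t] =ᵐ[μ] fun ω =>
      -(((M ^ k)ᵀ * warArg M S Γ h * M ^ k * Y t ω).trace +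
        K * (warArg M S Γ h * warSigma M S k).trace) - K / 2 * Real.log (warDet M S Γ h) := by
  have hA := posSemidef_warArg hY.posSemidef_innovation hΓ M h
  have h1 := condExp_sub (hY.integrable_trace_add hint k hA).neg
    (integrable_const (μ := μ) (K / 2 * Real.log (warDet M S Γ h))) (𝓕 t)
  filter_upwards [h1, condExp_neg (μ := μ) (fun ω => (warArg M S Γ h * Y (t + k) ω).trace) (𝓕 t),
    hY.condExp_trace_add hint k hA] with ω e1 e2 e3
  refine e1.trans ?_
  rw [Pi.sub_apply, e2, Pi.neg_apply, e3, condExp_const (𝓕.le t)]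

end Decomposition

theorem corollary8 {Ω : Type*} {mΩ : MeasurableSpace Ω} (μ : Measure Ω) [IsProbabilityMeasure μ]
    (𝓕 : Filtration ℕ mΩ) {n : ℕ} (K : ℝ) (M S : Matrix (Fin n) (Fin n) ℝ)
    (Y : ℕ → Ω → Matrix (Fin n) (Fin n) ℝ) (hY : IsWAR μ 𝓕 K M S Y)
    (t : ℕ) (hint : ∀ i j, Integrable (fun ω => Y t ω i j) μ)
    (Γ : Matrix (Fin n) (Fin n) ℝ) (hΓ : Γ.PosSemidef) :
    -- the matrices `Id + 2 Σ_m Γ` are invertible, with positive determinant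
    (∀ m : ℕ, 0 < (1 + (2 : ℝ) • (warSigma M S m * Γ)).det) ∧
    -- the conditional Laplace transform at every horizon
    (∀ h : ℕ, condLaplace μ 𝓕 Y Γ h t =ᵐ[μ] fun ω =>
      Real.exp (-((M ^ h).transpose * (Γ * (1 + (2 : ℝ) • (warSigma M S h * Γ))⁻¹) * M ^ h *
          Y t ω).trace) /
        (1 + (2 : ℝ) • (warSigma M S h * Γ)).det ^ (K / 2)) ∧
    -- the decomposition, all of whose terms are well defined
    (∀ h : ℕ, Integrable (feldTotalLog μ 𝓕 Y Γ h t) μ ∧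
      (∀ k < h, Integrable (feldTermLog μ 𝓕 Y Γ h k t) μ) ∧
      feldTotal μ 𝓕 Y Γ h t =ᵐ[μ] fun ω =>
        ∑ k ∈ Finset.range h, feldTerm μ 𝓕 Y Γ h k t ω) ∧
    -- its generic term
    (∀ h k : ℕ, k < h → feldTerm μ 𝓕 Y Γ h k t =ᵐ[μ] fun ω =>
      ((M ^ h).transpose *
          (Γ * (1 + (2 : ℝ) • (warSigma M S (h - k - 1) * Γ))⁻¹ -
            Γ * (1 + (2 : ℝ) • (warSigma M S (h - k) * Γ))⁻¹) * M ^ h * Y t ω).trace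
      + ((M ^ (h - k - 1)).transpose *
          (Γ * (1 + (2 : ℝ) • (warSigma M S (h - k - 1) * Γ))⁻¹) * M ^ (h - k - 1) *
            (K • warSigma M S (k + 1))).trace
      - ((M ^ (h - k)).transpose *
          (Γ * (1 + (2 : ℝ) • (warSigma M S (h - k) * Γ))⁻¹) * M ^ (h - k) *
            (K • warSigma M S k)).trace
      - K / 2 * Real.log ((1 + (2 : ℝ) • (warSigma M S (h - k) * Γ)).det /
          (1 + (2 : ℝ) • (warSigma M S (h - k - 1) * Γ)).det)) := by
  have hS := hY.posSemidef_innovation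
  have hint' : ∀ C : Matrix (Fin n) (Fin n) ℝ, C.PosSemidef →
      Integrable (fun ω => (C * Y t ω).trace) μ := fun C _ => by
    simp only [trace, diag_apply, mul_apply]
    exact integrable_finsetSum _ fun i _ => integrable_finsetSum _ fun j _ =>
      (hint j i).const_mul _
  have hterm : ∀ h k, Integrable (feldTermLog μ 𝓕 Y Γ h k t) μ := fun h k =>
    ((hY.integrable_logLaplace hΓ hint' _ k).sub
      (hY.integrable_logLaplace hΓ hint' _ (k + 1))).congr (hY.feldTermLog_eq hΓ h k t).symm
  refine ⟨warDet_pos hS hΓ M, fun h => hY.condLaplace_eq hΓ h t, fun h => ⟨?_, fun k _ => hterm h k,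
    ?_⟩, fun h k hk => ?_⟩
  · exact ((hY.integrable_logLaplace hΓ hint' h 0).sub
      (hY.integrable_logLaplace hΓ hint' 0 h)).congr (hY.feldTotalLog_eq hΓ h t).symm
  · filter_upwards [condExp_congr_ae (m := 𝓕 t) (hY.feldTotalLog_eq_sum hΓ h t),
      condExp_finsetSum (μ := μ) (s := Finset.range h) (fun k _ => hterm h k) (𝓕 t)] with ω e1 e2
    rw [feldTotal, e1, e2, Finset.sum_apply]
    rfl
  -- `j = h - k - 1` removes the truncated subtractions.
  · obtain ⟨j, rfl⟩ : ∃ j, h = k + 1 + j := ⟨h - (k + 1), by omega⟩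
    have hj1 : k + 1 + j - k - 1 = j := by omega
    have hj : k + 1 + j - k = j + 1 := by omega
    have hlog := hY.feldTermLog_eq hΓ (k + 1 + j) k t
    rw [hj1, hj] at *
    filter_upwards [condExp_congr_ae (m := 𝓕 t) hlog,
      condExp_sub (hY.integrable_logLaplace hΓ hint' (j + 1) k)
        (hY.integrable_logLaplace hΓ hint' j (k + 1)) (𝓕 t),
      hY.condExp_logLaplace hΓ hint' (j + 1) k, hY.condExp_logLaplace hΓ hint' j (k + 1)]
      with ω e1 e2 e3 e4
    rw [feldTerm, e1]
    refine e2.trans ?_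
    rw [Pi.sub_apply, e3, e4]
    change _ = ((M ^ (k + 1 + j))ᵀ * (wishartArg (warSigma M S j) Γ -
      wishartArg (warSigma M S (j + 1)) Γ) * M ^ (k + 1 + j) * Y t ω).trace +
      (warArg M S Γ j * (K • warSigma M S (k + 1))).trace -
      (warArg M S Γ (j + 1) * (K • warSigma M S k)).trace -
      K / 2 * Real.log (warDet M S Γ (j + 1) / warDet M S Γ j)
    -- The pairs `(a, b) = (k, j + 1)` and `(k + 1, j)` both sum to `h`, so the two `Y t`
    -- coefficients share the outer factors `M^h`.
    have hpow : ∀ a b : ℕ, (M ^ a)ᵀ * warArg M S Γ b * M ^ a =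
        (M ^ (b + a))ᵀ * wishartArg (warSigma M S b) Γ * M ^ (b + a) := fun a b => by
      simp only [warArg, pow_add, transpose_mul, Matrix.mul_assoc]
    rw [hpow, hpow, show j + 1 + k = k + 1 + j by ring, show j + (k + 1) = k + 1 + j by ring,
      Real.log_div (warDet_pos hS hΓ M _).ne' (warDet_pos hS hΓ M _).ne', Matrix.mul_sub,
      Matrix.sub_mul, Matrix.sub_mul, trace_sub, Matrix.mul_smul, Matrix.mul_smul, trace_smul,
      trace_smul, smul_eq_mul, smul_eq_mul]
    ring

end
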